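/- Let $k \ge 1$ be an integer, $m = 4k+4$ and $\theta = 2\pi/m$. Let $P$ be a finite set of points in the Euclidean plane and let $S$ be a set of line segments (constraints) between two distinct points of $P$, no two of which intersect properly (that is, in exactly one point, interior to both). For each $u \in P$ let $C_0^u, \dots, C_{m-1}^u$ be the $m$ cones with apex $u$ and aperture $\theta$, numbered clockwise, such that the bisector of $C_0^u$ is the vertical halfline upwards from $u$. Assume that $P$ is in general position: no two points of $P$ lie on a line parallel to one of the rays bounding the cones, no two lie on a line perpendicular to the bisector of a cone, and no three are collinear. Two distinct points $u, v \in P$ can see each other if $uv$ is a constraint or $uv$ intersects no constraint properly. The visibility graph $\mathrm{Vis}(P,S)$ has vertex set $P$ and an edge between every two points that can see each other. For $u \in P$, the lines through the constraints $uc \in S$ with $c \in C_i^u$ split $C_i^u$ into subcones; each such $c$ belongs to both subcones next to $uc$, and a cone that is not split is a single subcone. The constrained $\theta_m$-graph has vertex set $P$; for each $u \in P$ and each subcone of each cone $C_i^u$ it has an edge from $u$ to the point $v$ of $P$ in that subcone, visible from $u$, for which $|uv'|$ is smallest, where $v'$ is the orthogonal projection of $v$ on the bisector of the original cone $C_i^u$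 (no edge if there is no such point). Edges are undirected. For a graph $G$ with vertex set $P$, let $d_G(u,v)$ be the smallest total Euclidean edge length of a path from $u$ to $v$ in $G$ ($\infty$ if there is none). For $t \ge 1$, a subgraph $H$ of $G$ with the same vertices is a $t$-spanner of $G$ if $d_H(u,v) \le t \cdot d_G(u,v)$ for all $u, v \in P$. Then the constrained $\theta_m$-graph with $m = 4k+4$ cones is a \[ \left(1 + \frac{2\sin(\theta/2)}{\cos(\theta/2) - \sin(\theta/2)}\right)\text{-spanner of } \mathrm{Vis}(P,S). \] -/

import Mathlib

open scoped ENNReal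

noncomputable section

namespace ThetaGraph

/-- The Euclidean plane. -/
abbrev Plane : Type := EuclideanSpace ℝ (Fin 2)

/-- The relative interiors of the segments `ab` and `cd` cross in exactly one point. -/
def ProperlyIntersect (a b c d : Plane) : Prop :=
  ∃ x, openSegment ℝ a b ∩ openSegment ℝ c d = {x}

/-! A set of line segments between two vertices of `P` is given as a `SimpleGraph` on `P`:
`S.Adj a b` says that the segment `ab` is one of the constraints. -/

/-- A set of constraints is planar if no two of its segments intersect properly. -/
def IsPlanar {P : Finset Plane} (S : SimpleGraph P) : Prop :=
  ∀ a b c d : P, S.Adj a b → S.Adj c d → ¬ ProperlyIntersect a b c d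

/-- `u` and `v` can see each other: `uv` is a constraint, or it properly intersects none. -/
def CanSee {P : Finset Plane} (S : SimpleGraph P) (u v : P) : Prop :=
  S.Adj u v ∨ ∀ a b : P, S.Adj a b → ¬ ProperlyIntersect u v a b

/-- The visibility graph of `P` with respect to the constraints `S`. -/
def Vis (P : Finset Plane) (S : SimpleGraph P) : SimpleGraph P where
  Adj u v := u ≠ v ∧ CanSee S u v
  symm := ⟨fun u v h => by
    refine ⟨h.1.symm, h.2.imp (fun e => e.symm) fun e a b hab => ?_⟩
    have := e a b hab
    unfold ProperlyIntersect at this ⊢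
    rwa [openSegment_symm ℝ (v : Plane) u]⟩
  loopless := ⟨fun _ h => h.1 rfl⟩

/-- The aperture of each of `m` cones. -/
def coneAngle (m : ℕ) : ℝ := 2 * Real.pi / m

/-- The unit vector at clockwise angle `φ` from the upward vertical direction. -/
def dir (φ : ℝ) : Plane := !₂[Real.sin φ, Real.cos φ]

/-- The direction of the bisector of the cone with index `i` (clockwise from the upward one). -/
def bisector (m : ℕ) (i : Fin m) : Plane := dir (((i : ℕ) : ℝ) * coneAngle m)

/-- The counterclockwise (left) bounding ray of the cone with index `i`. -/
def leftRay (m : ℕ) (i : Fin m) : Plane := dir ((((i : ℕ) : ℝ) - 1 / 2) * coneAngle m)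

/-- The clockwise (right) bounding ray of the cone with index `i`. -/
def rightRay (m : ℕ) (i : Fin m) : Plane := dir ((((i : ℕ) : ℝ) + 1 / 2) * coneAngle m)

/-- The cone with apex `u` and index `i`: the region between its two bounding rays. -/
def cone (m : ℕ) (u : Plane) (i : Fin m) : Set Plane :=
  {x | ∃ s t : ℝ, 0 ≤ s ∧ 0 ≤ t ∧ x = u + s • leftRay m i + t • rightRay m i}

/-- The side of the line `uc` on which `x` lies: positive for one of the two open half-planes,
negative for the other, and zero on the line. -/
def side (u c x : Plane) : ℝ :=
  (c 0 - u 0) * (x 1 - u 1) - (c 1 - u 1) * (x 0 - u 0)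

/-- `C` is one of the (closed) subcones into which the cone with apex `u` and index `i` is split by
the lines through those constraints at `u` whose other endpoint `c` lies in that cone. Each subcone
consists of the points of the cone that no such line strictly separates from some point `x` of
the cone lying on none of these lines. In particular `c` lies in both subcones next to `uc`, and a
cone that is not split is its only subcone. -/
def IsSubcone {P : Finset Plane} (S : SimpleGraph P) (m : ℕ) (u : P) (i : Fin m)
    (C : Set Plane) : Prop :=
  ∃ x ∈ cone m u i,
    (∀ c : P, S.Adj u c → (c : Plane) ∈ cone m u i → side u c x ≠ 0) ∧
    C = {y ∈ cone m u i |
      ∀ c : P, S.Adj u c → (c : Plane) ∈ cone m u i → 0 ≤ side u c x * side u c y}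

/-- The orthogonal projection of `v` on the bisector of the cone with apex `u` and index `i`
(the bisector is spanned by a unit vector). -/
def bisectorProj (m : ℕ) (u : Plane) (i : Fin m) (v : Plane) : Plane :=
  u + (inner ℝ (bisector m i) (v - u) : ℝ) • bisector m i

/-- `u` adds an edge to `v`: in some subcone of `u`, `v` is a closest vertex visible from `u`,
where distance is measured along the bisector of the original cone. -/
def AddsEdge {P : Finset Plane} (S : SimpleGraph P) (m : ℕ) (u v : P) : Prop :=
  ∃ (i : Fin m) (C : Set Plane), IsSubcone S m u i C ∧
    (v : Plane) ∈ C ∧ (Vis P S).Adj u v ∧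
    ∀ w : P, (w : Plane) ∈ C → (Vis P S).Adj u w →
      dist (u : Plane) (bisectorProj m u i v) ≤ dist (u : Plane) (bisectorProj m u i w)

/-- The constrained theta-graph with `m` cones: `u` and `v` are adjacent if `u ≠ v` and one of the
two adds an edge to the other. -/
def constrainedTheta (P : Finset Plane) (S : SimpleGraph P) (m : ℕ) : SimpleGraph P :=
  SimpleGraph.fromRel (AddsEdge S m)

/-- General position with respect to `m` cones: no two points on a line parallel to a ray bounding
a cone, no two points on a line perpendicular to a bisector, no three points collinear. -/
structure GeneralPosition (P : Finset Plane) (m : ℕ) : Prop where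
  not_parallel_left : ∀ u ∈ P, ∀ v ∈ P, u ≠ v → ∀ (i : Fin m) (t : ℝ), v - u ≠ t • leftRay m i
  not_parallel_right : ∀ u ∈ P, ∀ v ∈ P, u ≠ v → ∀ (i : Fin m) (t : ℝ), v - u ≠ t • rightRay m i
  not_perp : ∀ u ∈ P, ∀ v ∈ P, u ≠ v → ∀ i : Fin m, inner ℝ (bisector m i) (v - u) ≠ (0 : ℝ)
  not_collinear : ∀ u ∈ P, ∀ v ∈ P, ∀ w ∈ P, u ≠ v → u ≠ w → v ≠ w →
    ¬ Collinear ℝ ({u, v, w} : Set Plane)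

/-- The sum of the Euclidean lengths of the edges along a walk. -/
def walkLength {P : Finset Plane} {G : SimpleGraph P} {u v : P} (p : G.Walk u v) : ℝ≥0∞ :=
  (p.darts.map fun d => edist (d.fst : Plane) (d.snd : Plane)).sum

/-- The length of a shortest path from `u` to `v` in the geometric graph `G`
(`⊤` if there is none). -/
def graphDist {P : Finset Plane} (G : SimpleGraph P) (u v : P) : ℝ≥0∞ :=
  ⨅ p : G.Walk u v, walkLength p

/-- `H` is a `t`-spanner of `G`. -/
def IsSpanner {P : Finset Plane} (H G : SimpleGraph P) (t : ℝ) : Prop :=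
  1 ≤ t ∧ H ≤ G ∧ ∀ u v : P, graphDist H u v ≤ ENNReal.ofReal t * graphDist G u v

end ThetaGraph

end

/-! Let Y and X be the coordinates along and across the bisector of the cone at u that contains w,
and N = |Y| + |X| the ℓ¹-norm in this frame. The core is the bound d(u,w) ≤ c N(w - u) for visible u
and w, where c = 1/(cos(θ/2) - sin(θ/2)), by induction on N(w - u)
(`graphDist_constrainedTheta_le`).

Let v be the neighbour of u in a subcone containing w. Inside the cone (cos(θ/2) - sin(θ/2))|uv| ≤
Y(v - u) - |X(v - u)|, which bounds the cost of the edge uv. Inside the triangle uvw, visibility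
edges lead from v to w with directions in the convex cone K between w - u and a half of the X-axis
(`dist_le_of_triangle`). On K the norm N is dominated by a linear functional L, which adds up along
the edges, and L(w - v) ≤ N(w - u) - (Y(v - u) - |X(v - u)|). So every edge has smaller N, and the
two costs sum to at most c N(w - u) (`dist_le_of_neighbour`).

The induction hypothesis for an edge refers to the frame of its own cone, not to that of the cone at
u. Here it matters that 4 divides the number of cones: the ℓ¹-norm is invariant under quarter turns,
which are multiples of θ, so a vector has its smallest norm in the frame of its own cone
(`exists_mem_cone`). Finally N(w - u) ≤ (cos(θ/2) + sin(θ/2))|uw|, and the product of the two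
factors is the spanning ratio. -/

noncomputable section

namespace ThetaGraph

/-! ### Cross products and segments -/

/-- The cross product of two vectors of the plane. -/
def cross (a b : Plane) : ℝ := a 0 * b 1 - a 1 * b 0

theorem side_eq_cross (u c x : Plane) : side u c x = cross (c - u) (x - u) := by
  simp [side, cross]

theorem cross_add_left (a b c : Plane) : cross (a + b) c = cross a c + cross b c := by
  simp [cross]; ring

theorem cross_add_right (a b c : Plane) : cross a (b + c) = cross a b + cross a c := by
  simp [cross]; ring

theorem cross_smul_left (r : ℝ) (a b : Plane) : cross (r • a) b = r * cross a b := by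
  simp [cross]; ring

theorem cross_smul_right (r : ℝ) (a b : Plane) : cross a (r • b) = r * cross a b := by
  simp [cross]; ring

@[simp]
theorem cross_self (a : Plane) : cross a a = 0 := by
  simp [cross]; ring

theorem cross_swap (a b : Plane) : cross a b = -cross b a := by
  simp [cross]; ring

theorem exists_eq_smul_add_smul {p q : Plane} (h : cross p q ≠ 0) (v : Plane) :
    ∃ s t : ℝ, v = s • p + t • q := by
  refine ⟨cross v q / cross p q, cross p v / cross p q, ?_⟩
  ext i
  fin_cases i <;> simp <;>
    rw [div_mul_eq_mul_div, div_mul_eq_mul_div, ← add_div, eq_div_iff h] <;>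
    unfold cross <;> ring

theorem collinear_of_cross_eq_zero {u v w : Plane} (huv : u ≠ v)
    (h : cross (v - u) (w - u) = 0) : Collinear ℝ ({u, v, w} : Set Plane) := by
  have key : ∃ r : ℝ, w - u = r • (v - u) := by
    have h' : (v 0 - u 0) * (w 1 - u 1) = (v 1 - u 1) * (w 0 - u 0) := by
      simp [cross] at h; linarith
    by_cases h0 : v 0 - u 0 = 0
    · have h1 : v 1 - u 1 ≠ 0 := by
        intro h1
        apply huv
        ext i
        fin_cases i <;> simp <;> linarith
      refine ⟨(w 1 - u 1) / (v 1 - u 1), ?_⟩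
      ext i
      fin_cases i <;> simp <;> field_simp
      linarith
    · refine ⟨(w 0 - u 0) / (v 0 - u 0), ?_⟩
      ext i
      fin_cases i <;> simp <;> field_simp
      linarith
  obtain ⟨r, hr⟩ := key
  rw [collinear_iff_of_mem (p₀ := u) (by simp)]
  refine ⟨v - u, ?_⟩
  simp only [Set.mem_insert_iff, Set.mem_singleton_iff, vadd_eq_add]
  rintro x (rfl | rfl | rfl)
  · exact ⟨0, by simp⟩
  · exact ⟨1, by simp⟩
  · exact ⟨r, by rw [← hr]; simp⟩

theorem exists_of_mem_openSegment {a b x : Plane} (h : x ∈ openSegment ℝ a b) (u : Plane) :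
    ∃ r : ℝ, 0 < r ∧ r < 1 ∧ x - u = (1 - r) • (a - u) + r • (b - u) := by
  obtain ⟨s, r, hs, hr, hsr, rfl⟩ := h
  refine ⟨r, hr, by linarith, ?_⟩
  obtain rfl : s = 1 - r := by linarith
  module

theorem mem_openSegment_of_eq {a b x u : Plane} {r : ℝ} (h0 : 0 < r) (h1 : r < 1)
    (h : x - u = (1 - r) • (a - u) + r • (b - u)) : x ∈ openSegment ℝ a b := by
  refine ⟨1 - r, r, by linarith, h0, by ring, ?_⟩
  have : x = (1 - r) • (a - u) + r • (b - u) + u := by rw [← h]; simp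
  rw [this]; module

/-! ### Crossing constraints in general position -/

/-- No three distinct points of `P` lie on a line. -/
def NoThreeCollinear (P : Finset Plane) : Prop :=
  ∀ u v w : P, u ≠ v → u ≠ w → v ≠ w → cross ((v : Plane) - u) ((w : Plane) - u) ≠ 0

variable {P : Finset Plane} {S : SimpleGraph P}

theorem NoThreeCollinear.not_mem_openSegment (hN : NoThreeCollinear P) {a b c : P} (hab : a ≠ b) :
    (c : Plane) ∉ openSegment ℝ (a : Plane) b := by
  intro h
  obtain ⟨r, h0, h1, h⟩ := exists_of_mem_openSegment h a
  have hba : (b : Plane) - a ≠ 0 := sub_ne_zero.2 fun h => hab (Subtype.ext h.symm)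
  have hac : a ≠ c := by
    rintro rfl
    rw [sub_self, smul_zero, zero_add, eq_comm, smul_eq_zero] at h
    exact h.elim h0.ne' hba
  have hbc : b ≠ c := by
    rintro rfl
    have : (1 - r) • ((b : Plane) - a) = 0 := by
      rw [sub_smul, one_smul, sub_eq_zero]; simpa using h
    rcases smul_eq_zero.1 this with h | h
    · linarith
    · exact hba h
  apply hN a b c hab hac hbc
  rw [h]
  simp [cross_smul_right]

/-- Visibility, or planarity if `uv` is a constraint, excludes a single common point. So the
segments are parallel and overlap, all four endpoints are collinear, and general position leaves
only equal pairs of endpoints. -/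
theorem eq_of_mem_openSegments (hN : NoThreeCollinear P) (hS : IsPlanar S) {u v c d : P}
    (huv : (Vis P S).Adj u v) (hcd : S.Adj c d) {x : Plane}
    (hx : x ∈ openSegment ℝ (u : Plane) v) (hx' : x ∈ openSegment ℝ (c : Plane) d) :
    (u = c ∧ v = d) ∨ (u = d ∧ v = c) := by
  have hne : u ≠ v := huv.1
  have hnp : ¬ ProperlyIntersect (u : Plane) v c d := by
    rcases huv.2 with h | h
    · exact hS _ _ _ _ h hcd
    · exact h _ _ hcd
  obtain ⟨r, -, -, hr⟩ := exists_of_mem_openSegment hx u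
  obtain ⟨r', -, -, hr'⟩ := exists_of_mem_openSegment hx' c
  simp only [sub_self, smul_zero, zero_add] at hr hr'
  by_cases hc : cross ((v : Plane) - u) (d - c) = 0
  · have hc1 : cross ((v : Plane) - u) (c - u) = 0 := by
      have : (c : Plane) - u = r • ((v : Plane) - u) + (-r') • ((d : Plane) - c) := by
        rw [neg_smul, ← hr, ← hr']; abel
      rw [this, cross_add_right, cross_smul_right, cross_smul_right, hc]
      simp
    have hd1 : cross ((v : Plane) - u) (d - u) = 0 := by
      have : (d : Plane) - u = (c - u) + ((d : Plane) - c) := by abel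
      rw [this, cross_add_right, hc, hc1, add_zero]
    have h1 : c = u ∨ c = v := by
      by_contra! h
      exact hN u v c hne h.1.symm h.2.symm hc1
    have h2 : d = u ∨ d = v := by
      by_contra! h
      exact hN u v d hne h.1.symm h.2.symm hd1
    have := hcd.ne
    grind
  · exfalso
    refine hnp ⟨x, Set.eq_singleton_iff_unique_mem.2 ⟨⟨hx, hx'⟩, ?_⟩⟩
    rintro y ⟨hy, hy'⟩
    obtain ⟨a, -, -, ha⟩ := exists_of_mem_openSegment hy u
    obtain ⟨b, -, -, hb⟩ := exists_of_mem_openSegment hy' c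
    simp only [sub_self, smul_zero, zero_add] at ha hb
    have e1 : y - x = (a - r) • ((v : Plane) - u) := by
      rw [sub_smul, ← ha, ← hr]; abel
    have e2 : y - x = (b - r') • ((d : Plane) - c) := by
      rw [sub_smul, ← hb, ← hr']; abel
    have : cross (y - x) (y - x) = (a - r) * ((b - r') * cross ((v : Plane) - u) (d - c)) := by
      conv_lhs => rw [e2, cross_smul_right, ← e2, e1, cross_smul_left]
      ring
    rw [cross_self] at this
    rcases mul_eq_zero.1 this.symm with h | h
    · rw [h, zero_smul, sub_eq_zero] at e1; exact e1
    · rcases mul_eq_zero.1 h with h | h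
      · rw [h, zero_smul, sub_eq_zero] at e2; exact e2
      · exact absurd h hc

theorem vis_adj_of_forall {u v : P} (huv : u ≠ v)
    (h : ∀ c d : P, S.Adj c d → ∀ x ∈ openSegment ℝ (u : Plane) v,
      x ∈ openSegment ℝ (c : Plane) d → (u = c ∧ v = d) ∨ (u = d ∧ v = c)) :
    (Vis P S).Adj u v := by
  refine ⟨huv, ?_⟩
  by_cases hadj : S.Adj u v
  · exact Or.inl hadj
  refine Or.inr fun a b hab ⟨x, hx⟩ => ?_
  have hm : x ∈ openSegment ℝ (u : Plane) v ∩ openSegment ℝ (a : Plane) b := by rw [hx]; rfl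
  rcases h a b hab x hm.1 hm.2 with ⟨rfl, rfl⟩ | ⟨rfl, rfl⟩
  · exact hadj hab
  · exact hadj hab.symm

/-! ### Visibility inside a triangle with apex `u` -/

/-- No constraint at `u` enters the open angle spanned by `p` and `q`. -/
def NoConstraintBetween (S : SimpleGraph P) (u p q : P) : Prop :=
  ∀ c : P, S.Adj u c → ∀ s t : ℝ, 0 < s → 0 < t →
    (c : Plane) - u ≠ s • ((p : Plane) - u) + t • ((q : Plane) - u)

/-- The closed triangle with the vertices `u`, `p` and `q`. -/
def triangle (u p q : Plane) : Set Plane :=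
  {r | ∃ s t : ℝ, 0 ≤ s ∧ 0 ≤ t ∧ s + t ≤ 1 ∧ r - u = s • (p - u) + t • (q - u)}

theorem triangle_comm (u p q : Plane) : triangle u p q = triangle u q p := by
  ext r
  constructor <;> rintro ⟨s, t, hs, ht, hst, h⟩ <;>
    exact ⟨t, s, ht, hs, by linarith, by rw [h, add_comm]⟩

theorem NoConstraintBetween.symm {u p q : P} (h : NoConstraintBetween S u p q) :
    NoConstraintBetween S u q p := fun c hc s t hs ht => by
  rw [add_comm]; exact h c hc t s ht hs

/-- Locates where a constraint leaves the angle at `u`: the coordinate whose zero comes first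
vanishes while the other is still nonnegative. The sign of `s₁ * t₀ - t₁ * s₀` tells which one it
is. -/
theorem exists_first_exit {s₀ t₀ s₁ t₁ : ℝ} (hs : 0 < s₀) (ht : 0 < t₀)
    (h : ¬ (0 < s₁ ∧ 0 < t₁)) :
    ∃ r : ℝ, 0 < r ∧ r ≤ 1 ∧
      (((1 - r) * s₀ + r * s₁ = 0 ∧ 0 ≤ (1 - r) * t₀ + r * t₁) ∨
       (0 ≤ (1 - r) * s₀ + r * s₁ ∧ (1 - r) * t₀ + r * t₁ = 0)) := by
  by_cases hc : s₁ * t₀ ≤ t₁ * s₀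
  · have hs1 : s₁ ≤ 0 := by
      by_contra! hs1
      have : 0 < t₁ * s₀ := lt_of_lt_of_le (by positivity) hc
      exact h ⟨hs1, by by_contra! h'; nlinarith⟩
    have hd : 0 < s₀ - s₁ := by linarith
    refine ⟨s₀ / (s₀ - s₁), by positivity, (div_le_one hd).2 (by linarith), Or.inl ⟨?_, ?_⟩⟩
    · field_simp; ring
    · have : (1 - s₀ / (s₀ - s₁)) * t₀ + s₀ / (s₀ - s₁) * t₁ = (t₁ * s₀ - s₁ * t₀) / (s₀ - s₁) := by
        field_simp; ring
      rw [this]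
      exact div_nonneg (by linarith) hd.le
  · push Not at hc
    have ht1 : t₁ ≤ 0 := by
      by_contra! ht1
      have : 0 < s₁ * t₀ := lt_trans (by positivity) hc
      exact h ⟨by by_contra! h'; nlinarith, ht1⟩
    have hd : 0 < t₀ - t₁ := by linarith
    refine ⟨t₀ / (t₀ - t₁), by positivity, (div_le_one hd).2 (by linarith), Or.inr ⟨?_, ?_⟩⟩
    · have : (1 - t₀ / (t₀ - t₁)) * s₀ + t₀ / (t₀ - t₁) * s₁ = (s₁ * t₀ - t₁ * s₀) / (t₀ - t₁) := by
        field_simp; ring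
      rw [this]
      exact div_nonneg (by linarith) hd.le
    · field_simp; ring

/-- A constraint through a point `x` strictly inside the angle at `u` between the visible points
`p` and `q` cannot leave that angle through one of its sides, close to `u`. -/
theorem not_exit_through_side (hN : NoThreeCollinear P) (hS : IsPlanar S) {u p q c d : P}
    (huq : (Vis P S).Adj u q) (hfan : NoConstraintBetween S u p q)
    (hpq : cross ((p : Plane) - u) (q - u) ≠ 0) (hcd : S.Adj c d) {x : Plane}
    (hx : x ∈ openSegment ℝ (c : Plane) d) {s t : ℝ} (hs : 0 < s) (ht : 0 < t)
    (hxe : x - u = s • ((p : Plane) - u) + t • ((q : Plane) - u)) {r a : ℝ} (hr0 : 0 < r)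
    (hr1 : r ≤ 1) (ha0 : 0 ≤ a) (ha1 : a < 1)
    (hy : (1 - r) • (x - u) + r • ((d : Plane) - u) = a • ((q : Plane) - u)) : False := by
  obtain ⟨b, hb0, hb1, hb⟩ := exists_of_mem_openSegment hx u
  -- The point at fraction `r` of the way from `x` to `d` is at fraction `b + r * (1 - b)` from `c`
  -- to `d`.
  have hyc : a • ((q : Plane) - u) = (1 - (b + r * (1 - b))) • ((c : Plane) - u) +
      (b + r * (1 - b)) • ((d : Plane) - u) := by
    rw [← hy, hb]; module
  -- An exit before `d` crosses `uq` or has `u` inside the constraint. An exit at `d` puts `d`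
  -- inside `uq`, or `d = u` and the constraint enters the angle from `u`.
  rcases hr1.lt_or_eq with hr1 | rfl
  · have hmem : (u : Plane) + a • ((q : Plane) - u) ∈ openSegment ℝ (c : Plane) d := by
      refine mem_openSegment_of_eq (u := (u : Plane)) (r := b + r * (1 - b)) ?_ ?_ ?_
      · have := mul_pos hr0 (sub_pos.2 hb1); linarith
      · have := mul_pos (sub_pos.2 hr1) (sub_pos.2 hb1); linarith
      · rw [← hyc]; abel
    rcases ha0.lt_or_eq with ha0 | rfl
    · have hmem' : (u : Plane) + a • ((q : Plane) - u) ∈ openSegment ℝ (u : Plane) q :=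
        mem_openSegment_of_eq (u := (u : Plane)) ha0 ha1 (by simp)
      have hxq : cross (x - u) (q - u) = 0 := by
        rw [hb]
        rcases eq_of_mem_openSegments hN hS huq hcd hmem' hmem with ⟨rfl, rfl⟩ | ⟨rfl, rfl⟩ <;>
          simp [cross_smul_left]
      rw [hxe, cross_add_left, cross_smul_left, cross_smul_left, cross_self] at hxq
      simp [hs.ne', hpq] at hxq
    · rw [zero_smul, add_zero] at hmem
      exact hN.not_mem_openSegment hcd.ne hmem
  · simp only [sub_self, zero_smul, one_smul, zero_add] at hy
    rcases ha0.lt_or_eq with ha0 | rfl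
    · exact hN.not_mem_openSegment huq.1 (mem_openSegment_of_eq (x := (d : Plane))
        (u := (u : Plane)) ha0 ha1 (by simpa using hy))
    · have hdu : d = u := Subtype.ext (by simpa [sub_eq_zero] using hy)
      subst hdu
      refine hfan c hcd.symm ((1 - b)⁻¹ * s) ((1 - b)⁻¹ * t) ?_ ?_ ?_
      · have := sub_pos.2 hb1; positivity
      · have := sub_pos.2 hb1; positivity
      · rw [mul_smul, mul_smul, ← smul_add, ← hxe, hb, sub_self, smul_zero, add_zero, smul_smul,
          inv_mul_cancel₀ (sub_pos.2 hb1).ne', one_smul]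

/-- A constraint through a point strictly inside the angle at `u` between the visible points `p` and
`q` has its endpoint in that angle, if the endpoint is not beyond the triangle `u p q`. -/
theorem endpoint_between (hN : NoThreeCollinear P) (hS : IsPlanar S) {u p q c d : P}
    (hup : (Vis P S).Adj u p) (huq : (Vis P S).Adj u q) (hfan : NoConstraintBetween S u p q)
    (hpq : cross ((p : Plane) - u) (q - u) ≠ 0) (hcd : S.Adj c d) {x : Plane}
    (hx : x ∈ openSegment ℝ (c : Plane) d) {s t : ℝ} (hs : 0 < s) (ht : 0 < t)
    (hxe : x - u = s • ((p : Plane) - u) + t • ((q : Plane) - u)) (f : Plane →ₗ[ℝ] ℝ)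
    (hp : 0 < f (p - u)) (hq : 0 < f (q - u)) (hxp : f (x - u) ≤ f (p - u))
    (hxq : f (x - u) ≤ f (q - u)) (hdp : f (d - u) < f (p - u)) (hdq : f (d - u) < f (q - u)) :
    ∃ s' t' : ℝ, 0 < s' ∧ 0 < t' ∧
      (d : Plane) - u = s' • ((p : Plane) - u) + t' • ((q : Plane) - u) := by
  obtain ⟨s', t', hd⟩ := exists_eq_smul_add_smul hpq (d - u)
  by_cases h : 0 < s' ∧ 0 < t'
  · exact ⟨s', t', h.1, h.2, hd⟩
  exfalso
  obtain ⟨r, hr0, hr1, hr⟩ := exists_first_exit hs ht h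
  have hy : (1 - r) • (x - u) + r • ((d : Plane) - u) =
      ((1 - r) * s + r * s') • ((p : Plane) - u) + ((1 - r) * t + r * t') • ((q : Plane) - u) := by
    rw [hxe, hd]; module
  have hf : f ((1 - r) • (x - u) + r • ((d : Plane) - u)) =
      (1 - r) * f (x - u) + r * f (d - u) := by simp
  -- The value of `f` at the exit point is a mean of those at `x` and `d`, with positive weight on
  -- `d`. So the exit comes before `q` (or `p`) on its side.
  rcases hr with ⟨h1, h2⟩ | ⟨h1, h2⟩
  · rw [h1, zero_smul, zero_add] at hy
    refine not_exit_through_side hN hS huq hfan hpq hcd hx hs ht hxe hr0 hr1 h2 ?_ hy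
    rw [hy, map_smul, smul_eq_mul] at hf
    have : (1 - r) * f (x - u) + r * f (d - u) < f (q - u) := by
      nlinarith [mul_le_mul_of_nonneg_left hxq (sub_nonneg.2 hr1), mul_lt_mul_of_pos_left hdq hr0]
    exact lt_of_mul_lt_mul_right (by linarith) hq.le
  · rw [h2, zero_smul, add_zero] at hy
    rw [cross_swap, neg_ne_zero] at hpq
    refine not_exit_through_side hN hS hup hfan.symm hpq hcd hx ht hs (by rw [hxe, add_comm])
      hr0 hr1 h1 ?_ hy
    rw [hy, map_smul, smul_eq_mul] at hf
    have : (1 - r) * f (x - u) + r * f (d - u) < f (p - u) := by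
      nlinarith [mul_le_mul_of_nonneg_left hxp (sub_nonneg.2 hr1), mul_lt_mul_of_pos_left hdp hr0]
    exact lt_of_mul_lt_mul_right (by linarith) hp.le

/-- Of the two endpoints of a segment through `x`, one is not farther than `x`. -/
theorem exists_endpoint_le {x a b : Plane} (hx : x ∈ openSegment ℝ a b) (u : Plane)
    (f : Plane →ₗ[ℝ] ℝ) : f (a - u) ≤ f (x - u) ∨ f (b - u) ≤ f (x - u) := by
  obtain ⟨r, h0, h1, h⟩ := exists_of_mem_openSegment hx u
  rw [h, map_add, map_smul, map_smul, smul_eq_mul, smul_eq_mul]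
  by_contra! hc
  nlinarith [mul_lt_mul_of_pos_left hc.1 (sub_pos.2 h1), mul_lt_mul_of_pos_left hc.2 h0]

/-- The point of the triangle `u p q` closest to `u` in some direction is visible from `u`. -/
theorem vis_of_isMin (hN : NoThreeCollinear P) (hS : IsPlanar S) {u p q z : P}
    (hup : (Vis P S).Adj u p) (huq : (Vis P S).Adj u q) (hpq : p ≠ q)
    (hfan : NoConstraintBetween S u p q) (f : Plane →ₗ[ℝ] ℝ)
    (hp : 0 < f (p - u)) (hq : 0 < f (q - u)) (hzu : z ≠ u)
    (hz : (z : Plane) ∈ triangle u p q)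
    (hmin : ∀ r : P, r ≠ u → (r : Plane) ∈ triangle u p q → f (z - u) ≤ f (r - u)) :
    (Vis P S).Adj u z := by
  by_cases hzp : z = p
  · rwa [hzp]
  by_cases hzq : z = q
  · rwa [hzq]
  have hcr := hN u p q hup.1 huq.1 hpq
  have hfp := hmin p hup.1.symm ⟨1, 0, by simp, by simp, by simp, by simp⟩
  have hfq := hmin q huq.1.symm ⟨0, 1, by simp, by simp, by simp, by simp⟩
  obtain ⟨s, t, hs, ht, hst, hze⟩ := hz
  have hs : 0 < s := hs.lt_of_ne' fun h => by
    apply hN u q z huq.1 hzu.symm (Ne.symm hzq)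
    simp [hze, h, cross_smul_right]
  have ht : 0 < t := ht.lt_of_ne' fun h => by
    apply hN u p z hup.1 hzu.symm (Ne.symm hzp)
    simp [hze, h, cross_smul_right]
  have hfz : 0 < f (z - u) := by
    rw [hze, map_add, map_smul, map_smul, smul_eq_mul, smul_eq_mul]
    positivity
  refine vis_adj_of_forall hzu.symm fun c d hcd x hx hx' => ?_
  exfalso
  obtain ⟨l, hl0, hl1, hl⟩ := exists_of_mem_openSegment hx u
  simp only [sub_self, smul_zero, zero_add] at hl
  have hfx : f (x - u) < f (z - u) := by
    rw [hl, map_smul, smul_eq_mul]; nlinarith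
  -- An endpoint no farther than `x` stays in the angle and, being closer than `z`, even in the
  -- triangle, against the minimality of `z`.
  have main : ∀ c d : P, S.Adj c d → x ∈ openSegment ℝ (c : Plane) d →
      f (d - u) ≤ f (x - u) → False := by
    intro c d hcd hx' hd
    obtain ⟨s', t', hs', ht', hde⟩ := endpoint_between hN hS hup huq hfan hcr hcd hx'
      (s := l * s) (t := l * t) (by positivity) (by positivity)
      (by rw [hl, hze]; module) f hp hq (by linarith) (by linarith) (by linarith) (by linarith)
    have hdu : d ≠ u := by
      rintro rfl
      have := congrArg (fun v => cross v ((q : Plane) - d)) hde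
      simp only [sub_self] at this
      rw [cross_add_left, cross_smul_left, cross_smul_left, cross_self] at this
      simp [cross] at this hcr
      grind
    refine absurd (hmin d hdu ⟨s', t', hs'.le, ht'.le, ?_, hde⟩) (by linarith)
    by_contra! hst'
    rw [hde, map_add, map_smul, map_smul, smul_eq_mul, smul_eq_mul] at hd
    nlinarith [mul_le_mul_of_nonneg_left hfp hs'.le, mul_le_mul_of_nonneg_left hfq ht'.le]
  rcases exists_endpoint_le hx' u f with h | h
  · exact main d c hcd.symm (by rwa [openSegment_symm]) h
  · exact main c d hcd hx' h

/-- Applied to two sides at `u`, this gives a height whose level lines are parallel to the third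
side, which has height 1. -/
theorem exists_linear_eq_one {p q : Plane} (h : cross p q ≠ 0) :
    ∃ f : Plane →ₗ[ℝ] ℝ, f p = 1 ∧ f q = 1 := by
  refine ⟨{ toFun := fun v => (cross v q - cross v p) / cross p q
            map_add' := fun a b => by rw [cross_add_left, cross_add_left]; ring
            map_smul' := fun r a => by
              rw [cross_smul_left, cross_smul_left, RingHom.id_apply, smul_eq_mul]; ring }, ?_, ?_⟩
  · simp [h]
  · simp [cross_swap q p, h]

/-- If the triangle `u p q` contains no further points, then `p` and `q` can see each other. -/
theorem vis_of_triangle_empty (hN : NoThreeCollinear P) (hS : IsPlanar S) {u p q : P}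
    (hup : (Vis P S).Adj u p) (huq : (Vis P S).Adj u q) (hpq : p ≠ q)
    (hfan : NoConstraintBetween S u p q)
    (hempty : ∀ r : P, (r : Plane) ∈ triangle u p q → r = u ∨ r = p ∨ r = q) :
    (Vis P S).Adj p q := by
  have hcr := hN u p q hup.1 huq.1 hpq
  obtain ⟨f, hp, hq⟩ := exists_linear_eq_one hcr
  refine vis_adj_of_forall hpq fun c d hcd x hx hx' => ?_
  obtain ⟨l, hl0, hl1, hl⟩ := exists_of_mem_openSegment hx u
  have hfx : f (x - u) = 1 := by
    rw [hl, map_add, map_smul, map_smul, smul_eq_mul, smul_eq_mul, hp, hq]; ring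
  have main : ∀ c d : P, S.Adj c d → x ∈ openSegment ℝ (c : Plane) d →
      f (d - u) < 1 → False := by
    intro c d hcd hx' hd
    obtain ⟨s', t', hs', ht', hde⟩ := endpoint_between hN hS hup huq hfan hcr hcd hx'
      (by linarith) hl0 hl f (by rw [hp]; exact one_pos)
      (by rw [hq]; exact one_pos) (by rw [hp, hfx]) (by rw [hq, hfx]) (by rwa [hp]) (by rwa [hq])
    have hd' := hd
    rw [hde, map_add, map_smul, map_smul, smul_eq_mul, smul_eq_mul, hp, hq] at hd'
    rcases hempty d ⟨s', t', hs'.le, ht'.le, by linarith, hde⟩ with rfl | rfl | rfl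
    · have := congrArg f hde
      rw [sub_self, map_zero, map_add, map_smul, map_smul, hp, hq] at this
      simp at this
      linarith
    · linarith
    · linarith
  -- An endpoint below height 1 would lie in the triangle. Otherwise, as `x` has height 1, both
  -- endpoints lie on the line `pq` and hence are `p` and `q`.
  by_cases h1 : f (d - u) < 1
  · exact (main c d hcd hx' h1).elim
  by_cases h2 : f (c - u) < 1
  · exact (main d c hcd.symm (by rwa [openSegment_symm]) h2).elim
  push Not at h1 h2
  obtain ⟨b, hb0, hb1, hb⟩ := exists_of_mem_openSegment hx' u
  have hfb := congrArg f hb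
  rw [map_add, map_smul, map_smul, smul_eq_mul, smul_eq_mul, hfx] at hfb
  have h1' : f (d - u) = 1 := by nlinarith
  have h2' : f (c - u) = 1 := by nlinarith
  have key : ∀ e : P, f (e - u) = 1 → e = p ∨ e = q := by
    intro e he
    by_contra! hne
    obtain ⟨s', t', hee⟩ := exists_eq_smul_add_smul hcr (e - u)
    have h := he
    rw [hee, map_add, map_smul, map_smul, smul_eq_mul, smul_eq_mul, hp, hq] at h
    refine hN p q e hpq hne.1.symm hne.2.symm ?_
    have e1 : (e : Plane) - p = t' • ((q : Plane) - p) := by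
      have : (e : Plane) - p = (e - u) - (p - u) := by abel
      rw [this, hee]
      obtain rfl : s' = 1 - t' := by linarith
      module
    rw [e1, cross_smul_right, cross_self, mul_zero]
  have := hcd.ne
  rcases key c h2' with h | h <;> rcases key d h1' with h' | h' <;> grind

/-! ### Connecting two points by visibility edges across a triangle -/

theorem triangle_subset {u p q z : Plane} (hz : z ∈ triangle u p q) :
    triangle u p z ⊆ triangle u p q := by
  obtain ⟨s, t, hs, ht, hst, hze⟩ := hz
  rintro r ⟨a, b, ha, hb, hab, hre⟩
  refine ⟨a + b * s, b * t, by positivity, by positivity, by nlinarith, ?_⟩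
  rw [hre, hze]; module

theorem NoConstraintBetween.mono {u p q z : P} (h : NoConstraintBetween S u p q) {s t : ℝ}
    (hs : 0 < s) (ht : 0 < t)
    (hz : (z : Plane) - u = s • ((p : Plane) - u) + t • ((q : Plane) - u)) :
    NoConstraintBetween S u p z := by
  intro c hc a b ha hb he
  refine h c hc (a + b * s) (b * t) (by positivity) (by positivity) ?_
  rw [he, hz]; module

/-- By `hle`, `r` is not on the side of `u` of the parallel to `pq` through `z`. In that part of the
triangle `u p z`, `z - r` is a nonnegative combination of `q - p` and `z - p`. -/
theorem sub_mem_of_mem_triangle {K : Set Plane} (hadd : ∀ a ∈ K, ∀ b ∈ K, a + b ∈ K)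
    (hsmul : ∀ r : ℝ, 0 ≤ r → ∀ a ∈ K, r • a ∈ K) {u p q z r : Plane} {s t a b : ℝ}
    (ht : 0 < t) (hst : s + t < 1)
    (hz : z - u = s • (p - u) + t • (q - u)) (hab : a + b ≤ 1)
    (hr : r - u = a • (p - u) + b • (z - u)) (hle : s + t ≤ a + b * (s + t))
    (hpq : q - p ∈ K) (hpz : z - p ∈ K) : z - r ∈ K := by
  have h1 : 0 < 1 - (s + t) := by linarith
  have e : z - r = ((1 - a - b) * t / (1 - (s + t))) • (q - p) +
      ((a - (s + t) * (1 - b)) / (1 - (s + t))) • (z - p) := by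
    have e1 : z - p = (s - 1) • (p - u) + t • (q - u) := by
      have : z - p = (z - u) - (p - u) := by abel
      rw [this, hz]; module
    have e2 : z - r = ((1 - b) * s - a) • (p - u) + ((1 - b) * t) • (q - u) := by
      have : z - r = (z - u) - (r - u) := by abel
      rw [this, hr, hz]; module
    have e3 : q - p = (q - u) - (p - u) := by abel
    rw [e1, e2, e3]
    match_scalars <;> field_simp <;> ring
  rw [e]
  refine hadd _ (hsmul _ ?_ _ hpq) _ (hsmul _ ?_ _ hpz)
  · exact div_nonneg (mul_nonneg (by linarith) ht.le) h1.le
  · exact div_nonneg (by linarith) h1.le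

open Classical in
/-- If `u` sees `p` and `q`, then `p` and `q` are connected by visibility edges with directions in
the convex cone `K`, provided that `K` contains the directions from `p` to the points in the
triangle `u p q` and from these to `q`. So a bound for the distances `D` along such edges by a
linear functional extends to `p` and `q`. -/
theorem dist_le_of_triangle (hN : NoThreeCollinear P) (hS : IsPlanar S) (D : P → P → ℝ≥0∞)
    (hD : ∀ a b c, D a c ≤ D a b + D b c) {K : Set Plane} (hadd : ∀ a ∈ K, ∀ b ∈ K, a + b ∈ K)
    (hsmul : ∀ r : ℝ, 0 ≤ r → ∀ a ∈ K, r • a ∈ K) (L : Plane →ₗ[ℝ] ℝ) (hL : ∀ e ∈ K, 0 ≤ L e)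
    {c M : ℝ} (hc : 0 ≤ c)
    (hedge : ∀ a b : P, (Vis P S).Adj a b → (b : Plane) - a ∈ K → L (b - a) ≤ M →
      D a b ≤ ENNReal.ofReal (c * L (b - a)))
    (u : P) (n : ℕ) : ∀ p q : P,
      (Finset.univ.filter fun r : P => (r : Plane) ∈ triangle u p q).card ≤ n →
      (Vis P S).Adj u p → (Vis P S).Adj u q → p ≠ q → NoConstraintBetween S u p q →
      (∀ r : P, r ≠ u → (r : Plane) ∈ triangle u p q → (r : Plane) - p ∈ K ∧ (q : Plane) - r ∈ K) →
      L (q - p) ≤ M → D p q ≤ ENNReal.ofReal (c * L (q - p)) := by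
  induction n with
  | zero =>
    intro p q hcard
    have : p ∈ Finset.univ.filter fun r : P => (r : Plane) ∈ triangle u p q :=
      Finset.mem_filter.2 ⟨Finset.mem_univ _, 1, 0, by simp, by simp, by simp, by simp⟩
    rw [Finset.card_eq_zero.1 (Nat.le_zero.1 hcard)] at this
    simp at this
  | succ n ih =>
    intro p q hcard hup huq hpq hfan hK hM
    have hp : (p : Plane) ∈ triangle u p q := ⟨1, 0, by simp, by simp, by simp, by simp⟩
    have hq : (q : Plane) ∈ triangle u p q := ⟨0, 1, by simp, by simp, by simp, by simp⟩
    have hKpq : (q : Plane) - p ∈ K := (hK p hup.1.symm hp).2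
    have hcr := hN u p q hup.1 huq.1 hpq
    by_cases hempty : ∀ r : P, (r : Plane) ∈ triangle u p q → r = u ∨ r = p ∨ r = q
    · exact hedge p q (vis_of_triangle_empty hN hS hup huq hpq hfan hempty) hKpq hM
    push Not at hempty
    obtain ⟨f, hfp, hfq⟩ := exists_linear_eq_one hcr
    -- The split point is one of least height. It is visible from `u`, and no point of the triangle
    -- except `u` lies lower, which preserves the condition on `K` in both parts.
    obtain ⟨z, hz, hmin⟩ := (Finset.univ.filter fun r : P =>
      (r : Plane) ∈ triangle u p q ∧ r ≠ u ∧ r ≠ p ∧ r ≠ q).exists_min_image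
      (fun r : P => f ((r : Plane) - u)) (by
        obtain ⟨r, h⟩ := hempty
        exact ⟨r, by simpa using h⟩)
    simp only [Finset.mem_filter, Finset.mem_univ, true_and] at hz hmin
    obtain ⟨hzt, hzu, hzp, hzq⟩ := hz
    obtain ⟨s, t, hs, ht, hst, hze⟩ := hzt
    have hzt : (z : Plane) ∈ triangle u p q := ⟨s, t, hs, ht, hst, hze⟩
    have hs : 0 < s := hs.lt_of_ne' fun h => by
      apply hN u q z huq.1 hzu.symm hzq.symm
      simp [hze, h, cross_smul_right]
    have ht : 0 < t := ht.lt_of_ne' fun h => by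
      apply hN u p z hup.1 hzu.symm hzp.symm
      simp [hze, h, cross_smul_right]
    have hst : s + t < 1 := hst.lt_of_ne fun h => by
      apply hN p q z hpq hzp.symm hzq.symm
      have : (z : Plane) - p = t • ((q : Plane) - p) := by
        have : (z : Plane) - p = (z - u) - (p - u) := by abel
        rw [this, hze]
        obtain rfl : s = 1 - t := by linarith
        module
      rw [this, cross_smul_right, cross_self, mul_zero]
    have hf : ∀ (a b : ℝ) (v w : Plane), f (a • v + b • w) = a * f v + b * f w := by simp
    have hfz : f ((z : Plane) - u) = s + t := by rw [hze, hf, hfp, hfq]; ring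
    have hmin' : ∀ r : P, r ≠ u → (r : Plane) ∈ triangle u p q → s + t ≤ f ((r : Plane) - u) := by
      intro r hru hr
      by_cases hrp : r = p
      · rw [hrp, hfp]; exact hst.le
      by_cases hrq : r = q
      · rw [hrq, hfq]; exact hst.le
      rw [← hfz]
      exact hmin r ⟨hr, hru, hrp, hrq⟩
    have huz : (Vis P S).Adj u z := vis_of_isMin hN hS hup huq hpq hfan f
      (by rw [hfp]; exact one_pos) (by rw [hfq]; exact one_pos) hzu hzt
      (by rw [hfz]; exact hmin')
    obtain ⟨hKpz, hKzq⟩ := hK z hzu hzt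
    have hsub1 : triangle (u : Plane) p z ⊆ triangle u p q := triangle_subset hzt
    have hsub2 : triangle (u : Plane) z q ⊆ triangle u p q := by
      rw [triangle_comm (u : Plane) z q, triangle_comm (u : Plane) p q] at *
      exact triangle_subset hzt
    -- Each part loses one of `q` and `p`, so the number of points drops.
    have hq1 : (q : Plane) ∉ triangle u p z := by
      rintro ⟨a, b, ha, hb, hab, h⟩
      have h' := congrArg f h
      rw [hf, hfp, hfq, hfz] at h'
      have hb0 : b = 0 := by
        by_contra hb'
        have := hb.lt_of_ne' hb'
        nlinarith
      apply hcr
      rw [h, hb0]; simp [cross_smul_right]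
    have hp2 : (p : Plane) ∉ triangle u z q := by
      rintro ⟨a, b, ha, hb, hab, h⟩
      have h' := congrArg f h
      rw [hf, hfp, hfq, hfz] at h'
      have ha0 : a = 0 := by
        by_contra ha'
        have := ha.lt_of_ne' ha'
        nlinarith
      apply hcr
      rw [h, ha0]; simp [cross_smul_left]
    have hcard1 : (Finset.univ.filter fun r : P => (r : Plane) ∈ triangle u p z).card ≤ n := by
      refine Nat.lt_succ_iff.1 (lt_of_lt_of_le (Finset.card_lt_card ?_) hcard)
      refine Finset.ssubset_iff_of_subset (fun r hr => ?_) |>.2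
        ⟨q, by simpa using hq, by simpa using hq1⟩
      simp only [Finset.mem_filter, Finset.mem_univ, true_and] at hr ⊢
      exact hsub1 hr
    have hcard2 : (Finset.univ.filter fun r : P => (r : Plane) ∈ triangle u z q).card ≤ n := by
      refine Nat.lt_succ_iff.1 (lt_of_lt_of_le (Finset.card_lt_card ?_) hcard)
      refine Finset.ssubset_iff_of_subset (fun r hr => ?_) |>.2
        ⟨p, by simpa using hp, by simpa using hp2⟩
      simp only [Finset.mem_filter, Finset.mem_univ, true_and] at hr ⊢
      exact hsub2 hr
    have hLs : L (q - p) = L (z - p) + L (q - z) := by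
      rw [← map_add]; congr 1; abel
    -- Nonnegativity of `L` on `K` keeps both summands below `M`.
    have h0 := hL _ hKpz
    have h1 := hL _ hKzq
    have hfan' : NoConstraintBetween S u q z :=
      hfan.symm.mono ht hs (by rw [hze, add_comm])
    have i1 := ih p z hcard1 hup huz hzp.symm (hfan.mono hs ht hze) (by
      intro r hru hr
      refine ⟨(hK r hru (hsub1 hr)).1, ?_⟩
      have hle := hmin' r hru (hsub1 hr)
      obtain ⟨a, b, ha, hb, hab, hre⟩ := hr
      rw [hre, hf, hfp, hfz, mul_one] at hle
      exact sub_mem_of_mem_triangle hadd hsmul ht hst hze hab hre hle hKpq hKpz) (by linarith)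
    have i2 := ih z q hcard2 huz huq hzq hfan'.symm (by
      intro r hru hr
      refine ⟨?_, (hK r hru (hsub2 hr)).2⟩
      have hle := hmin' r hru (hsub2 hr)
      obtain ⟨a, b, ha, hb, hab, hre⟩ := hr
      rw [hre, hf, hfq, hfz, mul_one] at hle
      -- The mirror image of the previous case: `p` and `q` are exchanged and all directions
      -- reversed.
      have := sub_mem_of_mem_triangle (K := -K) (u := (u : Plane)) (p := q) (q := p) (z := z)
        (r := r) (s := t) (t := s) (a := b) (b := a)
        (fun a ha b hb => by
          rw [Set.mem_neg, neg_add]; exact hadd _ ha _ hb)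
        (fun r hr a ha => by rw [Set.mem_neg, ← smul_neg]; exact hsmul r hr _ ha)
        hs (by linarith) (by rw [hze, add_comm]) (by linarith) (by rw [hre, add_comm])
        (by linarith) (by simpa using hKpq) (by simpa using hKzq)
      simpa using this) (by linarith)
    refine (hD p z q).trans ((add_le_add i1 i2).trans ?_)
    rw [← ENNReal.ofReal_add (by positivity) (by positivity), hLs, mul_add]

/-! ### Path lengths -/

theorem graphDist_triangle (G : SimpleGraph P) (a b c : P) :
    graphDist G a c ≤ graphDist G a b + graphDist G b c := by
  unfold graphDist
  rw [ENNReal.iInf_add]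
  refine le_iInf fun p => ?_
  rw [ENNReal.add_iInf]
  refine le_iInf fun q => (iInf_le _ (p.append q)).trans ?_
  simp [walkLength, SimpleGraph.Walk.darts_append]

theorem graphDist_self (G : SimpleGraph P) (a : P) : graphDist G a a = 0 :=
  le_antisymm ((iInf_le _ SimpleGraph.Walk.nil).trans (by simp [walkLength])) bot_le

theorem graphDist_le_edist {G : SimpleGraph P} {a b : P} (h : G.Adj a b) :
    graphDist G a b ≤ edist (a : Plane) b :=
  (iInf_le _ (SimpleGraph.Walk.cons h SimpleGraph.Walk.nil)).trans (by simp [walkLength])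

theorem graphDist_le_mul_graphDist {G H : SimpleGraph P} {t : ℝ≥0∞} (ht₀ : t ≠ 0) (ht : t ≠ ⊤)
    (h : ∀ a b, G.Adj a b → graphDist H a b ≤ t * edist (a : Plane) b) (a b : P) :
    graphDist H a b ≤ t * graphDist G a b := by
  have main : ∀ {a b : P} (p : G.Walk a b), graphDist H a b ≤ t * walkLength p := by
    intro a b p
    induction p with
    | nil => simp [graphDist_self]
    | cons hab p ih =>
      refine (graphDist_triangle H _ _ _).trans ((add_le_add (h _ _ hab) ih).trans ?_)
      simp [walkLength, mul_add]
  unfold graphDist at *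
  rw [ENNReal.mul_iInf_of_ne ht₀ ht]
  exact le_iInf main

/-! ### Rotated ℓ¹-norms and cones -/

/-- The coordinate of a vector in the direction `dir β`. -/
def along (β : ℝ) : Plane →ₗ[ℝ] ℝ where
  toFun v := v 0 * Real.sin β + v 1 * Real.cos β
  map_add' a b := by simp; ring
  map_smul' r a := by simp; ring

/-- The coordinate of a vector in the direction clockwise perpendicular to `dir β`. -/
def across (β : ℝ) : Plane →ₗ[ℝ] ℝ where
  toFun v := v 0 * Real.cos β - v 1 * Real.sin β
  map_add' a b := by simp; ring
  map_smul' r a := by simp; ring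

/-- The `ℓ¹`-norm in the coordinate system with the axis `dir β`. -/
def rotatedNorm (β : ℝ) (v : Plane) : ℝ := |along β v| + |across β v|

theorem along_apply (β : ℝ) (v : Plane) : along β v = v 0 * Real.sin β + v 1 * Real.cos β := rfl

theorem across_apply (β : ℝ) (v : Plane) : across β v = v 0 * Real.cos β - v 1 * Real.sin β := rfl

theorem inner_dir (β : ℝ) (v : Plane) : inner ℝ (dir β) v = along β v := by
  simp [dir, along_apply, PiLp.inner_apply, Fin.sum_univ_two]

theorem norm_dir (β : ℝ) : ‖dir β‖ = 1 := by
  simp [dir, EuclideanSpace.norm_eq, Fin.sum_univ_two]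

theorem along_dir (β δ : ℝ) : along β (dir (β + δ)) = Real.cos δ := by
  simp only [along_apply, dir]
  simp only [Matrix.cons_val_zero, Matrix.cons_val_one, Matrix.cons_val_fin_one]
  rw [Real.sin_add, Real.cos_add]
  linear_combination Real.cos δ * Real.sin_sq_add_cos_sq β

theorem across_dir (β δ : ℝ) : across β (dir (β + δ)) = Real.sin δ := by
  simp only [across_apply, dir]
  simp only [Matrix.cons_val_zero, Matrix.cons_val_one, Matrix.cons_val_fin_one]
  rw [Real.sin_add, Real.cos_add]
  linear_combination Real.sin δ * Real.sin_sq_add_cos_sq β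

theorem norm_sq_eq (β : ℝ) (v : Plane) : ‖v‖ ^ 2 = along β v ^ 2 + across β v ^ 2 := by
  rw [EuclideanSpace.norm_sq_eq, Fin.sum_univ_two, Real.norm_eq_abs, Real.norm_eq_abs, sq_abs,
    sq_abs, along_apply, across_apply]
  linear_combination -(v 0 ^ 2 + v 1 ^ 2) * Real.sin_sq_add_cos_sq β

theorem cross_eq (β : ℝ) (v w : Plane) :
    cross v w = across β v * along β w - along β v * across β w := by
  rw [along_apply, across_apply, along_apply, across_apply, cross]
  linear_combination -(v 0 * w 1 - v 1 * w 0) * Real.sin_sq_add_cos_sq β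

theorem cross_dir (α β : ℝ) : cross (dir α) (dir β) = Real.sin (α - β) := by
  simp [cross, dir, Real.sin_sub]

theorem exists_eq_smul_dir (v : Plane) : ∃ r β : ℝ, 0 ≤ r ∧ v = r • dir β := by
  let z : ℂ := ⟨v 1, v 0⟩
  refine ⟨‖z‖, z.arg, norm_nonneg _, ?_⟩
  ext i
  fin_cases i
  · exact (Complex.norm_mul_sin_arg z).symm
  · exact (Complex.norm_mul_cos_arg z).symm

/-- As |sin| has period π, `r` can be reduced modulo `M`. For a nonzero remainder the shifted angle
stays at least π/(2M) ≥ |γ| away from 0 and π. -/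
theorem abs_sin_le_abs_sin_add {M : ℕ} (hM : 0 < M) {γ : ℝ} (hγ : |γ| ≤ Real.pi / (2 * M)) (r : ℤ) :
    |Real.sin γ| ≤ |Real.sin (γ + r * (Real.pi / M))| := by
  have hM' : (0 : ℝ) < M := Nat.cast_pos.2 hM
  have hM1 : (1 : ℝ) ≤ M := by exact_mod_cast hM
  have hMz : (0 : ℤ) < M := by exact_mod_cast hM
  have hdiv : (r : ℝ) = M * (r / (M : ℤ) : ℤ) + (r % (M : ℤ) : ℤ) := by
    exact_mod_cast (Int.mul_ediv_add_emod r M).symm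
  have h0 := Int.emod_nonneg r hMz.ne'
  have h1 := Int.emod_lt_of_pos r hMz
  set q := r / (M : ℤ)
  set e := r % (M : ℤ)
  have hsplit : γ + r * (Real.pi / M) = (γ + e * (Real.pi / M)) + q * Real.pi := by
    rw [hdiv]; field_simp; ring
  have habs : |Real.sin (γ + r * (Real.pi / M))| = |Real.sin (γ + e * (Real.pi / M))| := by
    rw [hsplit, Real.sin_add_int_mul_pi, abs_mul, abs_zpow, abs_neg, abs_one, one_zpow, one_mul]
  rw [habs]
  rcases h0.eq_or_lt with h0 | h0
  · rw [← h0]; simp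
  have he0 : (1 : ℝ) ≤ e := by exact_mod_cast h0
  have he1 : (e : ℝ) + 1 ≤ M := by exact_mod_cast h1
  have hpi := Real.pi_pos
  set x := Real.pi / (2 * M) with hx
  have hx0 : 0 < x := by positivity
  have hxM : Real.pi / M = 2 * x := by rw [hx]; field_simp
  have hxpi : 2 * (M * x) = Real.pi := by rw [hx]; field_simp
  have hxle : x ≤ Real.pi / 2 := by nlinarith
  rw [Real.abs_sin_eq_sin_abs_of_abs_le_pi (by linarith), hxM]
  have hl : x ≤ γ + e * (2 * x) := by nlinarith [neg_le_of_abs_le hγ]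
  have hr : γ + e * (2 * x) ≤ Real.pi - x := by nlinarith [le_of_abs_le hγ]
  refine le_trans ?_ (le_abs_self _)
  have hg := abs_nonneg γ
  by_cases hy : γ + e * (2 * x) ≤ Real.pi / 2
  · exact Real.sin_le_sin_of_le_of_le_pi_div_two (by linarith) hy (by linarith)
  · rw [← Real.sin_pi_sub (γ + e * (2 * x))]
    exact Real.sin_le_sin_of_le_of_le_pi_div_two (by linarith) (by linarith) (by linarith)

/-- Reduces the comparison of ℓ¹-norms in different frames to one of |sin| at the doubled angle. -/
theorem abs_cos_add_abs_sin_sq (x : ℝ) :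
    (|Real.cos x| + |Real.sin x|) ^ 2 = 1 + |Real.sin (2 * x)| := by
  rw [Real.sin_two_mul, abs_mul, abs_mul, abs_two, add_sq, sq_abs, sq_abs]
  linear_combination Real.sin_sq_add_cos_sq x

theorem abs_cos_add_abs_sin_le {M : ℕ} (hM : 0 < M) {δ : ℝ} (hδ : |δ| ≤ Real.pi / (4 * M)) (r : ℤ) :
    |Real.cos δ| + |Real.sin δ| ≤
      |Real.cos (δ + r * (Real.pi / (2 * M)))| + |Real.sin (δ + r * (Real.pi / (2 * M)))| := by
  refine le_of_sq_le_sq ?_ (by positivity)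
  rw [abs_cos_add_abs_sin_sq, abs_cos_add_abs_sin_sq]
  have hM' : (0 : ℝ) < M := Nat.cast_pos.2 hM
  have e : 2 * (δ + r * (Real.pi / (2 * M))) = 2 * δ + r * (Real.pi / M) := by field_simp
  rw [e]
  refine add_le_add_right (abs_sin_le_abs_sin_add hM ?_ r) 1
  rw [abs_mul, abs_two]
  have : Real.pi / (2 * M) = 2 * (Real.pi / (4 * M)) := by field_simp; ring
  linarith

theorem rotatedNorm_smul_dir {r : ℝ} (hr : 0 ≤ r) (β δ : ℝ) :
    rotatedNorm β (r • dir (β + δ)) = r * (|Real.cos δ| + |Real.sin δ|) := by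
  rw [rotatedNorm, map_smul, map_smul, along_dir, across_dir, smul_eq_mul, smul_eq_mul, abs_mul,
    abs_mul, abs_of_nonneg hr]
  ring

theorem dir_add_int_mul_two_pi (β : ℝ) (n : ℤ) : dir (β + n * (2 * Real.pi)) = dir β := by
  simp [dir, Real.sin_add_int_mul_two_pi, Real.cos_add_int_mul_two_pi]

/-- The vector `v` is a combination of the two rays enclosing the direction in the middle. -/
theorem exists_dir_eq {β φ δ : ℝ} (h0 : 0 < φ) (h1 : φ < Real.pi / 4) (hδ : |δ| ≤ φ) :
    ∃ s t : ℝ, 0 ≤ s ∧ 0 ≤ t ∧ dir (β + δ) = s • dir (β - φ) + t • dir (β + φ) := by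
  have hpi := Real.pi_pos
  have hs : 0 < Real.sin (2 * φ) := Real.sin_pos_of_pos_of_lt_pi (by linarith) (by linarith)
  obtain ⟨hl, hr⟩ := abs_le.1 hδ
  refine ⟨Real.sin (φ - δ) / Real.sin (2 * φ), Real.sin (φ + δ) / Real.sin (2 * φ),
    div_nonneg (Real.sin_nonneg_of_nonneg_of_le_pi (by linarith) (by linarith)) hs.le,
    div_nonneg (Real.sin_nonneg_of_nonneg_of_le_pi (by linarith) (by linarith)) hs.le, ?_⟩
  have key : Real.sin (2 * φ) • dir (β + δ) =
      Real.sin (φ - δ) • dir (β - φ) + Real.sin (φ + δ) • dir (β + φ) := by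
    ext i
    fin_cases i
    · simp [dir, Real.sin_add, Real.sin_sub, Real.cos_add, Real.cos_sub, Real.sin_two_mul]
      ring
    · simp [dir, Real.sin_add, Real.sin_sub, Real.cos_add, Real.cos_sub, Real.sin_two_mul]
      ring
  rw [div_eq_inv_mul, div_eq_inv_mul, mul_smul, mul_smul, ← smul_add, ← key, smul_smul,
    inv_mul_cancel₀ hs.ne', one_smul]

theorem coneAngle_eq (k : ℕ) : coneAngle (4 * k + 4) = Real.pi / (2 * ((k + 1 : ℕ) : ℝ)) := by
  unfold coneAngle
  push_cast
  have : (0 : ℝ) < (k : ℝ) + 1 := by positivity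
  have e : (4 * (k : ℝ) + 4) = 4 * ((k : ℝ) + 1) := by ring
  rw [e]; field_simp; ring

/-- Every point lies in a cone, and of the rotated norms that of this cone is the smallest. -/
theorem exists_mem_cone {k : ℕ} (hk : 1 ≤ k) (u x : Plane) :
    ∃ j : Fin (4 * k + 4), x ∈ cone (4 * k + 4) u j ∧ ∀ i : Fin (4 * k + 4),
      rotatedNorm ((j : ℕ) * coneAngle (4 * k + 4)) (x - u) ≤
        rotatedNorm ((i : ℕ) * coneAngle (4 * k + 4)) (x - u) := by
  obtain ⟨r, β, hr, hv⟩ := exists_eq_smul_dir (x - u)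
  have hθ := coneAngle_eq k
  have hmθ : ((4 * k + 4 : ℕ) : ℝ) * coneAngle (4 * k + 4) = 2 * Real.pi := by
    unfold coneAngle; field_simp
  have hpi := Real.pi_pos
  have hk' : (1 : ℝ) ≤ k := by exact_mod_cast hk
  have hθlt : coneAngle (4 * k + 4) < Real.pi / 2 := by
    rw [hθ]; push_cast
    exact div_lt_div_of_pos_left hpi (by norm_num) (by linarith)
  have hθ0 : 0 < coneAngle (4 * k + 4) := by rw [hθ]; positivity
  set θ := coneAngle (4 * k + 4) with hθd
  -- The index of the bisector nearest to the direction `β`, still to be reduced modulo `m`.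
  set n := round (β / θ) with hn
  have hδ : |β - n * θ| ≤ θ / 2 := by
    have h := abs_sub_round (β / θ)
    have : β - n * θ = (β / θ - n) * θ := by field_simp
    rw [this, abs_mul, abs_of_pos hθ0]
    nlinarith
  set m : ℤ := ((4 * k + 4 : ℕ) : ℤ) with hm
  have hm0 : 0 < m := by rw [hm]; positivity
  have he0 := Int.emod_nonneg n hm0.ne'
  have he1 := Int.emod_lt_of_pos n hm0
  let j : Fin (4 * k + 4) := ⟨(n % m).toNat, by omega⟩
  have hj : ((j : ℕ) : ℝ) = ((n % m : ℤ) : ℝ) := by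
    have : (((n % m).toNat : ℤ) : ℝ) = ((n % m : ℤ) : ℝ) := by rw [Int.toNat_of_nonneg he0]
    exact_mod_cast this
  have hdiv : (n : ℝ) = ((4 * k + 4 : ℕ) : ℝ) * (n / m : ℤ) + (n % m : ℤ) := by
    have := (Int.mul_ediv_add_emod n m).symm
    rw [hm] at this ⊢
    exact_mod_cast this
  set δ := β - n * θ with hδd
  have hβ : β = ((j : ℕ) * θ + δ) + (n / m : ℤ) * (2 * Real.pi) := by
    rw [hj, hδd, ← hmθ]
    linear_combination θ * hdiv
  have hv' : x - u = r • dir ((j : ℕ) * θ + δ) := by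
    rw [hv, hβ, dir_add_int_mul_two_pi]
  refine ⟨j, ?_, fun i => ?_⟩
  · obtain ⟨s, t, hs, ht, hst⟩ := exists_dir_eq (β := (j : ℕ) * θ) (φ := θ / 2) (by linarith)
      (by linarith) hδ
    refine ⟨r * s, r * t, by positivity, by positivity, ?_⟩
    have hl : leftRay (4 * k + 4) j = dir ((j : ℕ) * θ - θ / 2) := by
      rw [leftRay, ← hθd]; congr 1; ring
    have hr : rightRay (4 * k + 4) j = dir ((j : ℕ) * θ + θ / 2) := by
      rw [rightRay, ← hθd]; congr 1; ring
    rw [hl, hr, mul_smul, mul_smul, add_assoc, ← smul_add, ← hst, ← hv']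
    abel
  -- The frames of `i` and `j` differ by a multiple of θ = π/(2(k+1)), and `δ` is at most half of θ.
  · have h2 : (j : ℕ) * θ + δ = (i : ℕ) * θ + (δ + ((j : ℕ) - (i : ℕ) : ℤ) * θ) := by
      push_cast; ring
    have e1 : rotatedNorm ((j : ℕ) * θ) (x - u) = r * (|Real.cos δ| + |Real.sin δ|) := by
      rw [hv', rotatedNorm_smul_dir hr]
    have e2 := rotatedNorm_smul_dir hr ((i : ℕ) * θ) (δ + ((j : ℕ) - (i : ℕ) : ℤ) * θ)
    rw [← h2, ← hv'] at e2
    rw [e1, e2]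
    refine mul_le_mul_of_nonneg_left ?_ hr
    rw [hθ]
    refine abs_cos_add_abs_sin_le (Nat.succ_pos k) ?_ _
    refine hδ.trans (le_of_eq ?_)
    rw [hθ]; field_simp; ring

/-- The slope of the vectors in a cone is bounded. -/
theorem abs_across_mul_cos_le {m : ℕ} {u x : Plane} {i : Fin m} (hx : x ∈ cone m u i)
    (hc : 0 < Real.cos (coneAngle m / 2)) (hs : 0 < Real.sin (coneAngle m / 2)) :
    0 ≤ along ((i : ℕ) * coneAngle m) (x - u) ∧
    |across ((i : ℕ) * coneAngle m) (x - u)| * Real.cos (coneAngle m / 2) ≤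
      along ((i : ℕ) * coneAngle m) (x - u) * Real.sin (coneAngle m / 2) := by
  obtain ⟨s, t, hs0, ht0, rfl⟩ := hx
  have hl : leftRay m i = dir ((i : ℕ) * coneAngle m + -(coneAngle m / 2)) := by
    rw [leftRay]; congr 1; ring
  have hr : rightRay m i = dir ((i : ℕ) * coneAngle m + coneAngle m / 2) := by
    rw [rightRay]; congr 1; ring
  rw [add_assoc, add_sub_cancel_left, map_add, map_add, map_smul, map_smul, map_smul, map_smul, hl,
    hr, along_dir, along_dir, across_dir, across_dir, Real.cos_neg, Real.sin_neg]
  simp only [smul_eq_mul]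
  refine ⟨by positivity, ?_⟩
  have h : |s * -Real.sin (coneAngle m / 2) + t * Real.sin (coneAngle m / 2)| ≤
      (s + t) * Real.sin (coneAngle m / 2) := by
    rw [abs_le]
    constructor <;> nlinarith [mul_nonneg hs0 hs.le, mul_nonneg ht0 hs.le]
  nlinarith [mul_le_mul_of_nonneg_right h hc.le]

/-- If ψ is the angle between `v` and the axis, both bounds become sin 2ψ ≤ sin 2φ after squaring;
this is `hkey`. -/
theorem cos_sub_sin_mul_norm_le {β φ : ℝ} {v : Plane} (hs : 0 < Real.sin φ)
    (hsc : Real.sin φ < Real.cos φ) (h0 : 0 ≤ along β v)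
    (h : |across β v| * Real.cos φ ≤ along β v * Real.sin φ) :
    (Real.cos φ - Real.sin φ) * ‖v‖ ≤ along β v - |across β v| ∧
    rotatedNorm β v ≤ (Real.cos φ + Real.sin φ) * ‖v‖ := by
  rw [rotatedNorm, abs_of_nonneg h0]
  have hn := norm_sq_eq β v
  rw [← sq_abs (across β v)] at hn
  set Y := along β v
  set X := |across β v|
  have hX : 0 ≤ X := abs_nonneg _
  have hcs := Real.sin_sq_add_cos_sq φ
  set C := Real.cos φ
  set s := Real.sin φ
  have hXY : X ≤ Y := by
    have : X * C ≤ Y * C := h.trans (mul_le_mul_of_nonneg_left hsc.le h0)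
    exact le_of_mul_le_mul_right this (hs.trans hsc)
  -- Up to the factor ‖v‖, these are sin(ψ - φ) and -cos(ψ + φ).
  have hprod : 0 ≤ (C * X - s * Y) * (s * X - C * Y) := by
    refine mul_nonneg_of_nonpos_of_nonpos (by linarith) ?_
    nlinarith [mul_le_mul_of_nonneg_right hsc.le hX, mul_le_mul_of_nonneg_right hsc.le h0]
  have hkey : X * Y ≤ C * s * (X ^ 2 + Y ^ 2) := by
    have e : (C * X - s * Y) * (s * X - C * Y) = C * s * (X ^ 2 + Y ^ 2) - X * Y := by
      linear_combination (-X * Y) * hcs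
    linarith
  constructor
  · refine le_of_sq_le_sq ?_ (by linarith)
    rw [mul_pow, hn]
    have : (C - s) ^ 2 = 1 - 2 * (C * s) := by linear_combination hcs
    rw [this]; nlinarith
  · refine le_of_sq_le_sq ?_ (mul_nonneg (by linarith) (norm_nonneg _))
    rw [mul_pow, hn]
    have : (C + s) ^ 2 = 1 + 2 * (C * s) := by linear_combination hcs
    rw [this]; nlinarith

/-! ### Subcones and their neighbours -/

theorem GeneralPosition.noThreeCollinear {m : ℕ} (hP : GeneralPosition P m) :
    NoThreeCollinear P := fun u v w huv huw hvw h =>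
  hP.not_collinear u u.2 v v.2 w w.2 (fun h => huv (Subtype.ext h)) (fun h => huw (Subtype.ext h))
    (fun h => hvw (Subtype.ext h))
    (collinear_of_cross_eq_zero (fun h => huv (Subtype.ext h)) h)

theorem add_mem_cone {m : ℕ} {u x y z : Plane} {i : Fin m} (hx : x ∈ cone m u i)
    (hy : y ∈ cone m u i) {a b : ℝ} (ha : 0 ≤ a) (hb : 0 ≤ b)
    (hz : z - u = a • (x - u) + b • (y - u)) : z ∈ cone m u i := by
  obtain ⟨s, t, hs, ht, rfl⟩ := hx
  obtain ⟨s', t', hs', ht', rfl⟩ := hy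
  refine ⟨a * s + b * s', a * t + b * t', by positivity, by positivity, ?_⟩
  rw [← sub_add_cancel z u, hz]; module

theorem IsSubcone.triangle_subset {m : ℕ} {u : P} {i : Fin m} {C : Set Plane}
    (hC : IsSubcone S m u i C) {p q : Plane} (hp : p ∈ C) (hq : q ∈ C) : triangle u p q ⊆ C := by
  obtain ⟨x, hx, hx0, rfl⟩ := hC
  rintro r ⟨s, t, hs, ht, -, hr⟩
  refine ⟨add_mem_cone hp.1 hq.1 hs ht hr, fun c hc hcc => ?_⟩
  have h1 := hp.2 c hc hcc
  have h2 := hq.2 c hc hcc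
  have e : side u c r = s * side u c p + t * side u c q := by
    rw [side_eq_cross, hr, cross_add_right, cross_smul_right, cross_smul_right, side_eq_cross,
      side_eq_cross]
  rw [e]
  nlinarith [mul_nonneg hs h1, mul_nonneg ht h2]

/-- A constraint inside the angle would have `p` and `q` strictly on opposite sides, so it would
separate one of them from the witness `x` of the subcone. -/
theorem IsSubcone.noConstraintBetween {m : ℕ} {u : P} {i : Fin m} {C : Set Plane}
    (hC : IsSubcone S m u i C) {p q : P} (hp : (p : Plane) ∈ C) (hq : (q : Plane) ∈ C)
    (hpq : cross ((p : Plane) - u) (q - u) ≠ 0) : NoConstraintBetween S u p q := by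
  obtain ⟨x, hx, hx0, rfl⟩ := hC
  intro c hc s t hs ht hce
  have hcc : (c : Plane) ∈ cone m u i := add_mem_cone hp.1 hq.1 hs.le ht.le hce
  have h0 := hx0 c hc hcc
  have h1 := hp.2 c hc hcc
  have h2 := hq.2 c hc hcc
  have e1 : side u c p = -(t * cross ((p : Plane) - u) (q - u)) := by
    rw [side_eq_cross, hce, cross_add_left, cross_smul_left, cross_smul_left, cross_self,
      cross_swap ((q : Plane) - u)]
    ring
  have e2 : side u c q = s * cross ((p : Plane) - u) (q - u) := by
    rw [side_eq_cross, hce, cross_add_left, cross_smul_left, cross_smul_left, cross_self]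
    ring
  rw [e1] at h1
  rw [e2] at h2
  set D := cross ((p : Plane) - u) (q - u)
  have h3 : 0 ≤ side u c x * D := nonneg_of_mul_nonneg_left (b := s) (by linarith) hs
  have h4 : 0 ≤ -(side u c x * D) := nonneg_of_mul_nonneg_left (b := t) (by linarith) ht
  have h5 : side u c x * D = 0 := by linarith
  rcases mul_eq_zero.1 h5 with h | h
  · exact h0 h
  · exact hpq h

/-- If `uw` is a constraint, `w` lies on a dividing line and cannot be the witness. A small shift
along the right ray leaves that line, by general position, and crosses none of the others. -/
theorem exists_isSubcone {m : ℕ} (hP : GeneralPosition P m) (hm : Real.sin (coneAngle m) ≠ 0)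
    {u w : P} (huw : u ≠ w) {i : Fin m} (hw : (w : Plane) ∈ cone m u i) :
    ∃ C, IsSubcone S m u i C ∧ (w : Plane) ∈ C := by
  have hN := hP.noThreeCollinear
  have hcr : cross ((w : Plane) - u) (rightRay m i) ≠ 0 := by
    obtain ⟨s, t, hs, ht, hwe⟩ := hw
    have hwe' : (w : Plane) - u = s • leftRay m i + t • rightRay m i := by rw [hwe]; abel
    have hs0 : s ≠ 0 := by
      rintro rfl
      exact hP.not_parallel_right u u.2 w w.2 (fun h => huw (Subtype.ext h)) i t
        (by rw [hwe', zero_smul, zero_add])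
    rw [hwe', cross_add_left, cross_smul_left, cross_smul_left, cross_self, mul_zero, add_zero,
      leftRay, rightRay, cross_dir]
    refine mul_ne_zero hs0 ?_
    have e : (((i : ℕ) : ℝ) - 1 / 2) * coneAngle m - (((i : ℕ) : ℝ) + 1 / 2) * coneAngle m =
        -coneAngle m := by ring
    rwa [e, Real.sin_neg, neg_ne_zero]
  have hside : ∀ (c : P) (ε : ℝ), side u c (w + ε • rightRay m i) =
      side u c w + ε * cross ((c : Plane) - u) (rightRay m i) := by
    intro c ε
    rw [side_eq_cross, side_eq_cross, add_sub_right_comm, cross_add_right, cross_smul_right]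
  have hev : ∀ᶠ ε in nhdsWithin (0 : ℝ) (Set.Ioi 0), ∀ c : P, u ≠ c →
      side u c (w + ε • rightRay m i) ≠ 0 ∧
      0 ≤ side u c (w + ε • rightRay m i) * side u c w := by
    rw [Filter.eventually_all]
    intro c
    rw [Filter.eventually_imp_distrib_left]
    intro huc
    simp only [hside]
    by_cases hcw : c = w
    · subst hcw
      have h0 : side u c c = 0 := by rw [side_eq_cross, cross_self]
      filter_upwards [self_mem_nhdsWithin] with ε hε
      rw [h0, zero_add, mul_zero]
      exact ⟨mul_ne_zero (ne_of_gt hε) hcr, le_rfl⟩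
    · have h0 : side u c w ≠ 0 := by
        rw [side_eq_cross]; exact hN u c w huc huw hcw
      have hcont : Continuous fun ε : ℝ =>
          (side u c w + ε * cross ((c : Plane) - u) (rightRay m i)) * side u c w := by fun_prop
      have h1 : 0 < (side u c w + 0 * cross ((c : Plane) - u) (rightRay m i)) * side u c w := by
        rw [zero_mul, add_zero]; exact mul_self_pos.2 h0
      filter_upwards [nhdsWithin_le_nhds (hcont.continuousAt.eventually (lt_mem_nhds h1))] with ε hε
      exact ⟨fun h => by simp [h] at hε, hε.le⟩
  obtain ⟨ε, hε, hε0⟩ := (hev.and self_mem_nhdsWithin).exists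
  refine ⟨_, ⟨w + ε • rightRay m i, ?_, fun c hc _ => (hε c hc.ne).1, rfl⟩, hw,
    fun c hc _ => (hε c hc.ne).2⟩
  obtain ⟨s, t, hs, ht, hwe⟩ := hw
  exact ⟨s, t + ε, hs, add_nonneg ht (le_of_lt hε0), by rw [hwe]; module⟩

/-- The neighbour of `u` in a subcone that contains a point visible from `u`. -/
theorem exists_addsEdge {m : ℕ} {u w : P} {i : Fin m} {C : Set Plane}
    (hC : IsSubcone S m u i C) (hw : (w : Plane) ∈ C) (huw : (Vis P S).Adj u w)
    (hpos : ∀ x ∈ cone m u i, 0 ≤ along ((i : ℕ) * coneAngle m) (x - u)) :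
    ∃ v : P, (v : Plane) ∈ C ∧ (Vis P S).Adj u v ∧ (constrainedTheta P S m).Adj u v ∧
      ∀ z : P, (z : Plane) ∈ C → (Vis P S).Adj u z →
        along ((i : ℕ) * coneAngle m) (v - u) ≤ along ((i : ℕ) * coneAngle m) (z - u) := by
  classical
  obtain ⟨v, hv, hmin⟩ := (Finset.univ.filter fun z : P =>
    (z : Plane) ∈ C ∧ (Vis P S).Adj u z).exists_min_image
    (fun z : P => along ((i : ℕ) * coneAngle m) ((z : Plane) - u)) ⟨w, by simp [hw, huw]⟩
  simp only [Finset.mem_filter, Finset.mem_univ, true_and] at hv hmin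
  have hsub : C ⊆ cone m u i := by
    obtain ⟨x, -, -, rfl⟩ := hC
    exact fun y hy => hy.1
  have hdist : ∀ z : P, (z : Plane) ∈ C → dist (u : Plane) (bisectorProj m u i z) =
      along ((i : ℕ) * coneAngle m) ((z : Plane) - u) := by
    intro z hz
    rw [bisectorProj, dist_self_add_right, norm_smul, bisector, norm_dir, inner_dir, mul_one,
      Real.norm_eq_abs, abs_of_nonneg (hpos z (hsub hz))]
  refine ⟨v, hv.1, hv.2, ?_, fun z hz huz => hmin z ⟨hz, huz⟩⟩
  refine (SimpleGraph.fromRel_adj _ _ _).2 ⟨hv.2.1, Or.inl ⟨i, C, hC, hv.1, hv.2, ?_⟩⟩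
  intro z hz huz
  rw [hdist v hv.1, hdist z hz]
  exact hmin z ⟨hz, huz⟩

theorem constrainedTheta_le_vis (m : ℕ) : constrainedTheta P S m ≤ Vis P S := by
  intro u v h
  rcases (SimpleGraph.fromRel_adj _ _ _).1 h with ⟨-, ⟨i, C, -, -, h, -⟩ | ⟨i, C, -, -, h, -⟩⟩
  · exact h
  · exact h.symm

theorem sin_lt_cos_half_coneAngle {k : ℕ} (hk : 1 ≤ k) :
    0 < Real.sin (coneAngle (4 * k + 4) / 2) ∧
    Real.sin (coneAngle (4 * k + 4) / 2) < Real.cos (coneAngle (4 * k + 4) / 2) ∧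
    0 < Real.sin (coneAngle (4 * k + 4)) := by
  have hk' : (1 : ℝ) ≤ k := by exact_mod_cast hk
  have hpi := Real.pi_pos
  have h0 : 0 < coneAngle (4 * k + 4) := by rw [coneAngle_eq]; positivity
  have h1 : coneAngle (4 * k + 4) < Real.pi / 2 := by
    rw [coneAngle_eq]; push_cast
    exact div_lt_div_of_pos_left hpi (by norm_num) (by linarith)
  refine ⟨Real.sin_pos_of_pos_of_lt_pi (by linarith) (by linarith), ?_,
    Real.sin_pos_of_pos_of_lt_pi h0 (by linarith)⟩
  rw [← Real.cos_pi_div_two_sub]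
  exact Real.cos_lt_cos_of_nonneg_of_le_pi (by linarith) (by linarith) (by linarith)

/-! ### The inductive distance bound -/

/-- The distance of `u` and `w` is bounded by way of the neighbour `v` of `u`. -/
theorem dist_le_of_neighbour (hN : NoThreeCollinear P) (hS : IsPlanar S) (D : P → P → ℝ≥0∞)
    (hD : ∀ a b c, D a c ≤ D a b + D b c) {c β : ℝ} (hc : 0 ≤ c) {u v w : P}
    (huv : (Vis P S).Adj u v) (huw : (Vis P S).Adj u w) (hvw : v ≠ w)
    (hfan : NoConstraintBetween S u v w)
    (hDuv : D u v ≤ ENNReal.ofReal (c * (along β (v - u) - |across β (v - u)|)))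
    (hv : |across β (v - u)| < along β (v - u)) (hle : along β (v - u) ≤ along β (w - u))
    (hmin : ∀ z : P, (Vis P S).Adj u z → (z : Plane) ∈ triangle u v w →
      along β (v - u) ≤ along β (z - u))
    (ih : ∀ a b : P, (Vis P S).Adj a b →
      rotatedNorm β (b - a) < rotatedNorm β (w - u) →
      D a b ≤ ENNReal.ofReal (c * rotatedNorm β (b - a))) :
    D u w ≤ ENNReal.ofReal (c * rotatedNorm β (w - u)) := by
  classical
  have hcr := hN u v w huv.1 huw.1 hvw
  rw [cross_eq β] at hcr
  set Y := along β with hY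
  -- The axis is reflected if necessary, so that X/Y is smaller at `v - u` than at `w - u`.
  obtain ⟨X, hX, hκ⟩ : ∃ X : Plane →ₗ[ℝ] ℝ, (∀ e, |X e| = |across β e|) ∧
      X (v - u) * Y (w - u) - Y (v - u) * X (w - u) < 0 := by
    rcases hcr.lt_or_gt with h | h
    · exact ⟨across β, fun _ => rfl, h⟩
    · refine ⟨-across β, fun e => by simp, ?_⟩
      simp only [LinearMap.neg_apply]
      linarith
  have hnorm : ∀ e, rotatedNorm β e = |Y e| + |X e| := fun e => by rw [hX, rotatedNorm]
  rw [← hX] at hDuv hv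
  have hv0 : 0 < Y (v - u) := (abs_nonneg _).trans_lt hv
  set h := Y (w - u) with hh
  have hh0 : 0 < h := hv0.trans_le hle
  -- `K` is spanned by `w - u` and the positive X-axis. This `g` makes `L` equal to the rotated norm
  -- on both rays, so by convexity `L` dominates the norm on `K`.
  set g := (|X (w - u)| - X (w - u)) / h with hg
  have hg0 : 0 ≤ g := div_nonneg (sub_nonneg.2 (le_abs_self _)) hh0.le
  have hgh : g * h = |X (w - u)| - X (w - u) := by rw [hg]; field_simp
  let K : Set Plane := {e | 0 ≤ Y e ∧ 0 ≤ X e * h - Y e * X (w - u)}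
  let L : Plane →ₗ[ℝ] ℝ := X + (1 + g) • Y
  have hLe : ∀ e, L e = X e + (1 + g) * Y e := fun e => by simp [L]
  have hKL : ∀ e ∈ K, rotatedNorm β e ≤ L e := by
    rintro e ⟨h0, h1⟩
    rw [hnorm, hLe, abs_of_nonneg h0]
    have hgY := mul_nonneg hg0 h0
    rcases le_or_gt 0 (X e) with hx | hx
    · rw [abs_of_nonneg hx]; linarith
    · rw [abs_of_neg hx]
      have h2 : X e * h < 0 := mul_neg_of_neg_of_pos hx hh0
      have h3 : X (w - u) < 0 := by
        by_contra! h3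
        have := mul_nonneg h0 h3
        linarith
      rw [abs_of_neg h3] at hgh
      have h4 : 0 ≤ (2 * X e + g * Y e) * h := by
        have : (2 * X e + g * Y e) * h = 2 * (X e * h) + Y e * (g * h) := by ring
        rw [this, hgh]; linarith
      have := nonneg_of_mul_nonneg_left h4 hh0
      linarith
  have hL0 : ∀ e ∈ K, 0 ≤ L e := fun e he =>
    (add_nonneg (abs_nonneg _) (abs_nonneg _)).trans (hKL e he)
  have hLwv : L (w - v) ≤ rotatedNorm β (w - u) - (Y (v - u) - |X (v - u)|) := by
    have e : (w : Plane) - v = (w - u) - (v - u) := by abel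
    rw [e, map_sub, hLe, hLe, hnorm, ← hh, abs_of_pos hh0]
    have := mul_nonneg hg0 hv0.le
    have := neg_abs_le (X (v - u))
    linarith
  -- A lowest point of the triangle other than `u` is visible from `u`, so the minimality of `v`
  -- extends from the visible points to all.
  have htri : ∀ r : P, r ≠ u → (r : Plane) ∈ triangle u v w → Y (v - u) ≤ Y (r - u) := by
    intro r hru hr
    obtain ⟨z, hz, hzmin⟩ := (Finset.univ.filter fun r : P =>
      (r : Plane) ∈ triangle u v w ∧ r ≠ u).exists_min_image
      (fun r : P => Y ((r : Plane) - u)) ⟨r, by simp [hr, hru]⟩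
    simp only [Finset.mem_filter, Finset.mem_univ, true_and] at hz hzmin
    have huz := vis_of_isMin hN hS huv huw hvw hfan Y hv0 hh0 hz.2 hz.1
      fun r hru hr => hzmin r ⟨hr, hru⟩
    exact (hmin z huz hz.1).trans (hzmin r ⟨hr, hru⟩)
  have hchain : D v w ≤ ENNReal.ofReal (c * L (w - v)) := by
    refine dist_le_of_triangle hN hS D hD (K := K) ?_ ?_ L hL0 (M := L (w - v)) hc ?_ u _ v w
      le_rfl huv huw hvw hfan ?_ le_rfl
    · rintro a ⟨ha, ha'⟩ b ⟨hb, hb'⟩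
      refine ⟨?_, ?_⟩
      · rw [map_add]; linarith
      · rw [map_add, map_add]; linarith
    · rintro r hr a ⟨ha, ha'⟩
      refine ⟨?_, ?_⟩
      · rw [map_smul, smul_eq_mul]; positivity
      · rw [map_smul, map_smul, smul_eq_mul, smul_eq_mul]
        have := mul_nonneg hr ha'
        linarith
    -- By `hLwv` and `hv`, the norm of such an edge is strictly below that of `w - u`, as `ih`
    -- requires.
    · intro a b hab hK hM
      have h1 := hKL _ hK
      exact (ih a b hab (by linarith)).trans
        (ENNReal.ofReal_le_ofReal (mul_le_mul_of_nonneg_left h1 hc))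
    · intro r hru hr
      have h1 := htri r hru hr
      obtain ⟨s, t, hs, ht, hst, hre⟩ := hr
      have hYr : Y (r - u) = s * Y (v - u) + t * h := by rw [hre]; simp [hh]
      have hXr : X (r - u) = s * X (v - u) + t * X (w - u) := by rw [hre]; simp
      have e1 : (r : Plane) - v = (r - u) - (v - u) := by abel
      have e2 : (w : Plane) - r = (w - u) - (r - u) := by abel
      refine ⟨⟨?_, ?_⟩, ⟨?_, ?_⟩⟩
      · rw [e1, map_sub]; linarith
      · rw [e1, map_sub X ((r : Plane) - u), map_sub Y ((r : Plane) - u), hYr, hXr]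
        nlinarith [mul_nonneg_of_nonpos_of_nonpos (show s - 1 ≤ 0 by linarith) hκ.le]
      · rw [e2, map_sub, hYr, ← hh]
        nlinarith [mul_le_mul_of_nonneg_left hle hs]
      · rw [e2, map_sub X ((w : Plane) - u), map_sub Y ((w : Plane) - u), hYr, hXr, ← hh]
        nlinarith [mul_nonneg_of_nonpos_of_nonpos (show -s ≤ 0 by linarith) hκ.le]
  have hLK : 0 ≤ L (w - v) := by
    rw [hLe]
    have e : (w : Plane) - v = (w - u) - (v - u) := by abel
    refine (hL0 _ ⟨?_, ?_⟩).trans_eq (hLe _)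
    · rw [e, map_sub]; linarith
    · rw [e, map_sub X ((w : Plane) - u), map_sub Y ((w : Plane) - u), ← hh]; linarith
  refine (hD u v w).trans ((add_le_add hDuv hchain).trans ?_)
  rw [← ENNReal.ofReal_add (mul_nonneg hc (by linarith)) (mul_nonneg hc hLK), ← mul_add]
  exact ENNReal.ofReal_le_ofReal (mul_le_mul_of_nonneg_left (by linarith) hc)

/-- The distance in the constrained theta-graph of two points that can see each other. -/
theorem graphDist_constrainedTheta_le {k : ℕ} (hk : 1 ≤ k) (hP : GeneralPosition P (4 * k + 4))
    (hS : IsPlanar S) {c : ℝ}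
    (hc : c = 1 / (Real.cos (coneAngle (4 * k + 4) / 2) - Real.sin (coneAngle (4 * k + 4) / 2)))
    (T : P × P × Fin (4 * k + 4)) :
    (Vis P S).Adj T.1 T.2.1 → (T.2.1 : Plane) ∈ cone (4 * k + 4) T.1 T.2.2 →
      graphDist (constrainedTheta P S (4 * k + 4)) T.1 T.2.1 ≤
        ENNReal.ofReal (c * rotatedNorm ((T.2.2 : ℕ) * coneAngle (4 * k + 4)) (T.2.1 - T.1)) := by
  -- The induction is on a real number, which is well-founded because there are finitely many
  -- triples. The cone index belongs to the triple since it fixes the frame.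
  let N : P × P × Fin (4 * k + 4) → ℝ := fun T =>
    rotatedNorm ((T.2.2 : ℕ) * coneAngle (4 * k + 4)) (T.2.1 - T.1)
  have hwf : WellFounded fun a b => N a < N b := by
    have : IsTrans (P × P × Fin (4 * k + 4)) fun a b => N a < N b := ⟨fun _ _ _ => lt_trans⟩
    have : Std.Irrefl fun a b => N a < N b := ⟨fun _ => lt_irrefl _⟩
    exact Finite.wellFounded_of_trans_of_irrefl _
  induction T using hwf.induction with
  | _ T ih =>
  obtain ⟨u, w, i⟩ := T
  simp only [N] at ih ⊢
  intro huw hw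
  obtain ⟨hs0, hsc, hsθ⟩ := sin_lt_cos_half_coneAngle hk
  have hN := hP.noThreeCollinear
  have hd : 0 < Real.cos (coneAngle (4 * k + 4) / 2) - Real.sin (coneAngle (4 * k + 4) / 2) :=
    sub_pos.2 hsc
  have hc0 : 0 < c := by rw [hc]; positivity
  have hcone := fun x (hx : x ∈ cone (4 * k + 4) u i) =>
    abs_across_mul_cos_le hx (hs0.trans hsc) hs0
  obtain ⟨C, hC, hwC⟩ := exists_isSubcone (S := S) hP hsθ.ne' huw.1 hw
  obtain ⟨v, hvC, huv, hadj, hmin⟩ := exists_addsEdge hC hwC huw fun x hx => (hcone x hx).1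
  have hv : (v : Plane) ∈ cone (4 * k + 4) u i := by
    obtain ⟨x, -, -, rfl⟩ := hC
    exact hvC.1
  obtain ⟨hv0, hv1⟩ := hcone v hv
  have hvn := (cos_sub_sin_mul_norm_le hs0 hsc hv0 hv1).1
  have hDuv : graphDist (constrainedTheta P S (4 * k + 4)) u v ≤ ENNReal.ofReal (c *
      (along ((i : ℕ) * coneAngle (4 * k + 4)) (v - u) -
        |across ((i : ℕ) * coneAngle (4 * k + 4)) (v - u)|)) := by
    refine (graphDist_le_edist hadj).trans ?_
    rw [edist_dist, dist_comm, dist_eq_norm]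
    refine ENNReal.ofReal_le_ofReal ?_
    rw [hc, one_div, ← div_eq_inv_mul, le_div_iff₀ hd, mul_comm]
    exact hvn
  by_cases hvw : v = w
  · subst hvw
    refine hDuv.trans (ENNReal.ofReal_le_ofReal (mul_le_mul_of_nonneg_left ?_ hc0.le))
    rw [rotatedNorm]
    have := le_abs_self (along ((i : ℕ) * coneAngle (4 * k + 4)) ((v : Plane) - u))
    have := abs_nonneg (across ((i : ℕ) * coneAngle (4 * k + 4)) ((v : Plane) - u))
    linarith
  refine dist_le_of_neighbour hN hS _ (graphDist_triangle _) hc0.le huv huw hvw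
    (hC.noConstraintBetween hvC hwC (hN u v w huv.1 huw.1 hvw)) hDuv ?_ (hmin w hwC huw)
    (fun z huz hz => hmin z (hC.triangle_subset hvC hwC hz) huz) fun a b hab hlt => ?_
  · have : 0 < ‖(v : Plane) - u‖ :=
      norm_pos_iff.2 (sub_ne_zero.2 fun h => huv.1 (Subtype.ext h.symm))
    have := mul_pos hd this
    linarith
  -- Change of frame: the edge `ab` is handled in its own cone `j`, where its norm is at most that
  -- in the frame of `i`.
  · obtain ⟨j, hj, hle⟩ := exists_mem_cone hk (a : Plane) b
    exact (ih (a, b, j) ((hle i).trans_lt hlt) hab hj).trans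
      (ENNReal.ofReal_le_ofReal (mul_le_mul_of_nonneg_left (hle i) hc0.le))

end ThetaGraph

end

theorem mainTheorem4 (k : ℕ) (hk : 1 ≤ k) (P : Finset ThetaGraph.Plane)
    (hP : ThetaGraph.GeneralPosition P (4 * k + 4))
    (S : SimpleGraph P) (hS : ThetaGraph.IsPlanar S) (θ : ℝ)
    (hθ : θ = 2 * Real.pi / (4 * (k : ℝ) + 4)) :
    ThetaGraph.IsSpanner (ThetaGraph.constrainedTheta P S (4 * k + 4)) (ThetaGraph.Vis P S)
      (1 + 2 * Real.sin (θ / 2) / (Real.cos (θ / 2) - Real.sin (θ / 2))) := by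
  open ThetaGraph in
  obtain rfl : θ = coneAngle (4 * k + 4) := by rw [hθ, coneAngle]; push_cast; rfl
  obtain ⟨hs0, hsc, -⟩ := sin_lt_cos_half_coneAngle hk
  have hd := sub_pos.2 hsc
  have ht : 1 ≤ 1 + 2 * Real.sin (coneAngle (4 * k + 4) / 2) /
      (Real.cos (coneAngle (4 * k + 4) / 2) - Real.sin (coneAngle (4 * k + 4) / 2)) := by
    have : 0 ≤ 2 * Real.sin (coneAngle (4 * k + 4) / 2) /
      (Real.cos (coneAngle (4 * k + 4) / 2) - Real.sin (coneAngle (4 * k + 4) / 2)) := by positivity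
    linarith
  refine ⟨ht, constrainedTheta_le_vis _, graphDist_le_mul_graphDist
    (ENNReal.ofReal_pos.2 (by linarith)).ne' ENNReal.ofReal_ne_top fun a b hab => ?_⟩
  obtain ⟨j, hj, -⟩ := exists_mem_cone hk (a : Plane) b
  refine (graphDist_constrainedTheta_le hk hP hS rfl (a, b, j) hab hj).trans ?_
  rw [edist_dist, dist_comm, dist_eq_norm, ← ENNReal.ofReal_mul (by linarith)]
  refine ENNReal.ofReal_le_ofReal ?_
  obtain ⟨h0, h1⟩ := abs_across_mul_cos_le hj (hs0.trans hsc) hs0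
  have h2 := (cos_sub_sin_mul_norm_le hs0 hsc h0 h1).2
  -- The ratio is (cos + sin)/(cos - sin) = 1 + 2 sin/(cos - sin) at half the cone angle.
  refine (mul_le_mul_of_nonneg_left h2 (one_div_pos.2 hd).le).trans (le_of_eq ?_)
  field_simp
  ring
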